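/- Let $q\ge 1$ and $d\ge q$ be integers, let $\mathcal S_q^+$ be the set of real symmetric positive definite $q\times q$ matrices, and let $\boldsymbol\Sigma\in\mathcal S_q^+$. Let $\boldsymbol S\sim\mathrm{Wishart}_q(d,\boldsymbol\Sigma)$, that is, $\boldsymbol S$ is a random matrix distributed as $\sum_{k=1}^d \boldsymbol X_k\boldsymbol X_k^\top$ with $\boldsymbol X_1,\dots,\boldsymbol X_d$ independent $\mathcal N_q(\boldsymbol 0,\boldsymbol\Sigma)$ vectors. For $\boldsymbol A\in\mathcal S_q^+$, its Cholesky factor is the unique lower triangular matrix $\boldsymbol R$ with positive diagonal entries such that $\boldsymbol A=\boldsymbol R\boldsymbol R^\top$. For $\boldsymbol S_1,\boldsymbol S_2\in\mathcal S_q^+$ with Cholesky factors $\boldsymbol R^{(1)},\boldsymbol R^{(2)}$, the log-Cholesky distance $d_{\mathrm{LC}}$ is given by $$d_{\mathrm{LC}}(\boldsymbol S_1,\boldsymbol S_2)^2=\sum_{1\le j<i\le q}\bigl(R^{(1)}_{ij}-R^{(2)}_{ij}\bigr)^2+\sum_{i=1}^q\bigl(\log R^{(1)}_{ii}-\log R^{(2)}_{ii}\bigr)^2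 .$$ Let $\boldsymbol L$ be the Cholesky factor of $\boldsymbol\Sigma$, and let $\boldsymbol T$ be the lower triangular matrix with entries $$T_{ii}=L_{ii}\sqrt2\,\exp\left\{\frac12\,\psi\left(\frac{d-i+1}{2}\right)\right\}\quad(1\le i\le q),\qquad T_{ij}=L_{ij}\sqrt2\,\frac{\Gamma((d-j+2)/2)}{\Gamma((d-j+1)/2)}\quad(1\le j<i\le q),$$ where $\Gamma$ is the gamma function and $\psi=\Gamma'/\Gamma$ is the digamma function. Then $\boldsymbol S\in\mathcal S_q^+$ almost surely, $\mathsf E[d_{\mathrm{LC}}(\boldsymbol S,\boldsymbol M)^2]<\infty$ for every $\boldsymbol M\in\mathcal S_q^+$, and $\boldsymbol T\boldsymbol T^\top\in\mathcal S_q^+$ is the unique Fréchet mean of $\boldsymbol S$ under the log-Cholesky distance, that is, the unique minimizer of $\boldsymbol M\mapsto\mathsf E[d_{\mathrm{LC}}(\boldsymbol S,\boldsymbol M)^2]$ over $\boldsymbol M\in\mathcal S_q^+$. -/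

import Mathlib

open MeasureTheory ProbabilityTheory

/-- The product sigma-algebra on real matrices (every entry is a measurable function). It is the
Borel sigma-algebra of the usual topology. -/
instance instMeasurableSpaceRealMatrix {m n : Type*} : MeasurableSpace (Matrix m n ℝ) :=
  inferInstanceAs (MeasurableSpace (m → n → ℝ))

/-- The Wishart distribution with `d` degrees of freedom and scale matrix `C`: the law of
`∑ k, X_k X_kᵀ` for `X_1, …, X_d` independent centred Gaussian vectors with covariance `C`. -/
noncomputable def wishartMeasure (q d : ℕ) (C : Matrix (Fin q) (Fin q) ℝ) :
    Measure (Matrix (Fin q) (Fin q) ℝ) :=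
  (Measure.pi fun _ : Fin d => multivariateGaussian (0 : EuclideanSpace ℝ (Fin q)) C).map
    fun X => ∑ k : Fin d, Matrix.vecMulVec (X k).ofLp (X k).ofLp

/-- `R` is the Cholesky factor of `S`: it is lower triangular with positive diagonal entries, and
`S = R Rᵀ`. -/
structure IsCholeskyFactor {q : ℕ} (S R : Matrix (Fin q) (Fin q) ℝ) : Prop where
  lower : ∀ i j, i < j → R i j = 0
  diag_pos : ∀ i, 0 < R i i
  eq_mul_transpose : S = R * R.transpose

/-- Every real positive definite matrix has a Cholesky factor. -/
theorem exists_isCholeskyFactor {q : ℕ} {S : Matrix (Fin q) (Fin q) ℝ} (hS : S.PosDef) :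
    ∃ R, IsCholeskyFactor S R := by
  classical
  have htri : ∀ i j, i < j → LDL.lower hS i j = 0 := by
    have h1 : (LDL.lowerInv hS).BlockTriangular OrderDual.toDual := by
      intro i j hij
      exact LDL.lowerInv_triangular hS (by simpa using hij)
    have h2 := Matrix.blockTriangular_inv_of_blockTriangular h1
    intro i j hij
    exact h2 (by simpa using hij)
  have hdet : (LDL.lower hS).det ≠ 0 := by
    have h := congrArg Matrix.det (LDL.lower_conj_diag hS)
    intro h0
    rw [Matrix.det_mul, Matrix.det_mul, h0] at h
    simp only [zero_mul] at h
    exact hS.det_pos.ne h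
  have hdiag : ∀ i, LDL.lower hS i i ≠ 0 := by
    rw [Matrix.det_of_isLowerTriangular _ (fun i j hij => htri i j (by simpa using hij))] at hdet
    intro i
    exact Finset.prod_ne_zero_iff.mp hdet i (Finset.mem_univ i)
  have hD : ∀ i, 0 < LDL.diagEntries hS i := by
    have hpd : (LDL.diag hS).PosDef := by
      rw [LDL.diag_eq_lowerInv_conj]
      refine hS.mul_mul_conjTranspose_same ?_
      exact Matrix.vecMul_injective_of_isUnit (isUnit_of_invertible (LDL.lowerInv hS))
    intro i
    have := hpd.diag_pos (i := i)
    simpa [LDL.diag] using this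
  -- `s i` carries the sign of the diagonal entry and the square root of the pivot
  let s : Fin q → ℝ := fun i =>
    SignType.sign (LDL.lower hS i i) * Real.sqrt (LDL.diagEntries hS i)
  have hs : ∀ i, s i * s i = LDL.diagEntries hS i := by
    intro i
    have h1 : ((SignType.sign (LDL.lower hS i i) : SignType) : ℝ) *
        ((SignType.sign (LDL.lower hS i i) : SignType) : ℝ) = 1 := by
      rcases lt_or_gt_of_ne (hdiag i) with h | h
      · simp [sign_neg h]
      · simp [sign_pos h]
    calc s i * s i = (SignType.sign (LDL.lower hS i i) * SignType.sign (LDL.lower hS i i)) *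
          (Real.sqrt (LDL.diagEntries hS i) * Real.sqrt (LDL.diagEntries hS i)) := by
          simp only [s]; ring
      _ = _ := by rw [h1, Real.mul_self_sqrt (hD i).le, one_mul]
  refine ⟨LDL.lower hS * Matrix.diagonal s, ?_, ?_, ?_⟩
  · intro i j hij
    simp [Matrix.mul_diagonal, htri i j hij]
  · intro i
    rw [Matrix.mul_diagonal]
    have h1 : LDL.lower hS i i * ((SignType.sign (LDL.lower hS i i) : SignType) : ℝ) =
        |LDL.lower hS i i| := by rw [self_mul_sign]
    have h2 : LDL.lower hS i i * s i = |LDL.lower hS i i| * Real.sqrt (LDL.diagEntries hS i) := by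
      rw [← h1]; simp only [s]; ring
    rw [h2]
    exact mul_pos (abs_pos.mpr (hdiag i)) (Real.sqrt_pos.mpr (hD i))
  · have h := LDL.lower_conj_diag hS
    rw [Matrix.conjTranspose_eq_transpose_of_trivial] at h
    rw [Matrix.transpose_mul, Matrix.diagonal_transpose, Matrix.mul_assoc,
      ← Matrix.mul_assoc (Matrix.diagonal s), Matrix.diagonal_mul_diagonal]
    simp_rw [hs]
    rw [← Matrix.mul_assoc]
    exact h.symm

open Classical in
/-- The Cholesky factor of a positive definite matrix (zero, by convention, for other matrices). -/
noncomputable def choleskyFactor {q : ℕ} (S : Matrix (Fin q) (Fin q) ℝ) :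
    Matrix (Fin q) (Fin q) ℝ :=
  if h : S.PosDef then (exists_isCholeskyFactor h).choose else 0

theorem choleskyFactor_spec {q : ℕ} {S : Matrix (Fin q) (Fin q) ℝ} (hS : S.PosDef) :
    IsCholeskyFactor S (choleskyFactor S) := by
  rw [choleskyFactor, dif_pos hS]
  exact (exists_isCholeskyFactor hS).choose_spec

/-- The Cholesky factor is unique. -/
theorem IsCholeskyFactor.unique {q : ℕ} {S R R' : Matrix (Fin q) (Fin q) ℝ}
    (h : IsCholeskyFactor S R) (h' : IsCholeskyFactor S R') : R = R' := by
  have hlow : ∀ {R : Matrix (Fin q) (Fin q) ℝ}, IsCholeskyFactor S R →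
      R.BlockTriangular OrderDual.toDual :=
    fun hR i j hij => hR.lower i j (by simpa using hij)
  have hdet : R'.det ≠ 0 := by
    rw [Matrix.det_of_isLowerTriangular _ (hlow h')]
    exact Finset.prod_ne_zero_iff.mpr fun i _ => (h'.diag_pos i).ne'
  have hu : IsUnit R'.det := isUnit_iff_ne_zero.mpr hdet
  have : Invertible R' := Matrix.invertibleOfIsUnitDet R' hu
  have hRA : R' * (R'⁻¹ * R) = R := Matrix.mul_nonsing_inv_cancel_left R' R hu
  generalize hA : R'⁻¹ * R = A at hRA
  have hAlow : A.BlockTriangular OrderDual.toDual := by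
    rw [← hA]
    exact (Matrix.blockTriangular_inv_of_blockTriangular (hlow h')).mul (hlow h)
  have hAA : A * A.transpose = 1 := by
    have h1 : R * R.transpose = R' * R'.transpose :=
      h.eq_mul_transpose.symm.trans h'.eq_mul_transpose
    have hut : IsUnit R'.transpose.det := by rwa [Matrix.det_transpose]
    rw [← hA, Matrix.transpose_mul, Matrix.transpose_nonsing_inv, Matrix.mul_assoc,
      ← Matrix.mul_assoc R, h1, Matrix.mul_assoc R', Matrix.mul_nonsing_inv _ hut,
      Matrix.mul_one, Matrix.nonsing_inv_mul _ hu]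
  have : Invertible A := Matrix.invertibleOfIsUnitDet A (Matrix.isUnit_det_of_right_inverse hAA)
  have hAt : A.transpose.BlockTriangular OrderDual.toDual := by
    rw [← Matrix.inv_eq_right_inv hAA]
    exact Matrix.blockTriangular_inv_of_blockTriangular hAlow
  have hoff : ∀ i j, i ≠ j → A i j = 0 := by
    intro i j hij
    rcases lt_or_gt_of_ne hij with hlt | hgt
    · exact hAlow (by simpa using hlt)
    · exact hAt (i := j) (j := i) (by simpa using hgt)
  have hAdiag : A = Matrix.diagonal fun i => A i i := by
    ext i j
    by_cases hij : i = j
    · subst hij; simp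
    · rw [Matrix.diagonal_apply_ne _ hij, hoff i j hij]
  have hone : ∀ i, A i i = 1 := by
    intro i
    have h1 : A i i * A i i = 1 := by
      have := congrFun (congrFun hAA i) i
      rw [hAdiag] at this
      simpa using this
    have h2 : R' i i * A i i = R i i := by
      have := congrFun (congrFun hRA i) i
      rw [hAdiag, Matrix.mul_diagonal] at this
      exact this
    have h3 : 0 < A i i := by
      have := h.diag_pos i
      rw [← h2] at this
      exact (mul_pos_iff_of_pos_left (h'.diag_pos i)).mp this
    nlinarith
  have : A = 1 := by
    rw [hAdiag]; simp [hone]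
  rw [← hRA, this, Matrix.mul_one]

/-- The log-Cholesky distance between two positive definite matrices: the Euclidean distance
between the strictly lower triangular parts of the Cholesky factors together with the logarithms
of their diagonals. -/
noncomputable def logCholeskyDist {q : ℕ} (S₁ S₂ : Matrix (Fin q) (Fin q) ℝ) : ℝ :=
  Real.sqrt
    ((∑ i, ∑ j ∈ Finset.Iio i, (choleskyFactor S₁ i j - choleskyFactor S₂ i j) ^ 2) +
      ∑ i, (Real.log (choleskyFactor S₁ i i) - Real.log (choleskyFactor S₂ i i)) ^ 2)

/-- `m` is a Fréchet mean of the random element `Y` in the space `A` with distance function `dist`: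
the expected squared distance from `Y` to each point of `A` is finite, and `m` minimizes it
over `A`. -/
def IsFrechetMean {Ω E : Type*} [MeasurableSpace Ω] (A : Set E) (dist : E → E → ℝ)
    (P : Measure Ω) (Y : Ω → E) (m : E) : Prop :=
  m ∈ A ∧ (∀ y ∈ A, Integrable (fun ω => dist (Y ω) y ^ 2) P) ∧
    ∀ y ∈ A, ∫ ω, dist (Y ω) m ^ 2 ∂P ≤ ∫ ω, dist (Y ω) y ^ 2 ∂P

/-! In the coordinates R_ij (j < i) and log R_ii of the Cholesky factor, the positive definite
matrices become a full Euclidean space and the log-Cholesky distance becomes the Euclidean one. The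
Fréchet mean is therefore the coordinatewise expectation: by the bias-variance identity
(`integral_logCholeskyDist_sq`), the expected squared distance to M exceeds its value at the mean by
exactly the squared distance between the two. What remains is to compute E R_ij and E log R_ii.

For this, write S = L W Lᵀ, where W is the Gram matrix of q independent standard Gaussian vectors
g_1, …, g_q in ℝ^d (`wishartMeasure_eq_map`). The Cholesky factor of S is then L G, with G the
factor of W, whose entries are read off from Gram-Schmidt: G_kj is the inner product of g_k with the
j-th orthonormalised vector. Two facts from Bartlett's decomposition suffice; joint independence of
the entries of G is not needed. (a) For j < k the direction is independent of g_k, so E G_kj = 0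
(`integral_gramCholesky_of_lt`). (b) G_jj is the norm of the projection of g_j onto an independent
random subspace, almost surely of dimension d - j + 1, so it has a chi law (`map_norm_gramSchmidt`).
Hence E (LG)_ij = L_ij E G_jj and E log (LG)_ii = log L_ii + E log G_ii. In polar coordinates the
chi moments become a quotient of Gamma values and a digamma value. -/

/-! ### Algebra and measurability of the Cholesky factor -/

instance instStandardBorelSpaceRealMatrix {m n : Type*} [Countable m] [Countable n] :
    StandardBorelSpace (Matrix m n ℝ) :=
  inferInstanceAs (StandardBorelSpace (m → n → ℝ))

theorem measurable_matrix_apply {m n : Type*} (i : m) (j : n) :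
    Measurable fun A : Matrix m n ℝ => A i j :=
  (measurable_pi_apply j).comp (measurable_pi_apply (X := fun _ => n → ℝ) i)

theorem measurable_matrix_iff {Ω m n : Type*} [MeasurableSpace Ω] {f : Ω → Matrix m n ℝ} :
    Measurable f ↔ ∀ i j, Measurable fun ω => f ω i j :=
  ⟨fun h i j => (measurable_matrix_apply i j).comp h, fun h =>
    measurable_pi_iff.2 fun i => measurable_pi_iff.2 fun j => h i j⟩

namespace IsCholeskyFactor

variable {q : ℕ} {S R : Matrix (Fin q) (Fin q) ℝ}

theorem blockTriangular (h : IsCholeskyFactor S R) : R.BlockTriangular OrderDual.toDual :=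
  fun i j hij => h.lower i j (by simpa using hij)

theorem det_ne_zero (h : IsCholeskyFactor S R) : R.det ≠ 0 := by
  rw [Matrix.det_of_isLowerTriangular _ h.blockTriangular]
  exact Finset.prod_ne_zero_iff.mpr fun i _ => (h.diag_pos i).ne'

theorem posDef (h : IsCholeskyFactor S R) : S.PosDef := by
  have hu : IsUnit R := (Matrix.isUnit_iff_isUnit_det R).2 (isUnit_iff_ne_zero.2 h.det_ne_zero)
  rw [h.eq_mul_transpose, ← Matrix.conjTranspose_eq_transpose_of_trivial]
  simpa using Matrix.PosDef.one.mul_mul_conjTranspose_same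
    (B := R) (Matrix.vecMul_injective_of_isUnit hu)

theorem choleskyFactor_eq (h : IsCholeskyFactor S R) : choleskyFactor S = R :=
  (choleskyFactor_spec h.posDef).unique h

/-- Lower triangular matrices with positive diagonal are closed under products. This reduces a
general scale matrix to the identity. -/
theorem mul_left (h : IsCholeskyFactor S R) {C L : Matrix (Fin q) (Fin q) ℝ}
    (hL : IsCholeskyFactor C L) : IsCholeskyFactor (L * S * L.transpose) (L * R) where
  lower i j hij := (hL.blockTriangular.mul h.blockTriangular) (by simpa using hij)
  diag_pos i := by
    rw [Matrix.mul_apply, Finset.sum_eq_single i]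
    · exact mul_pos (hL.diag_pos i) (h.diag_pos i)
    · intro k _ hk
      rcases lt_or_gt_of_ne hk with hk | hk
      · rw [h.lower k i hk, mul_zero]
      · rw [hL.lower i k hk, zero_mul]
    · simp
  eq_mul_transpose := by
    rw [h.eq_mul_transpose, Matrix.transpose_mul]
    simp only [Matrix.mul_assoc]

end IsCholeskyFactor

/-- The lower triangular matrices with positive diagonal. -/
def lowerTriangularPos (q : ℕ) : Set (Matrix (Fin q) (Fin q) ℝ) :=
  {R | (∀ i j, i < j → R i j = 0) ∧ ∀ i, 0 < R i i}

theorem isCholeskyFactor_mul_transpose {q : ℕ} {R : Matrix (Fin q) (Fin q) ℝ}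
    (h : R ∈ lowerTriangularPos q) : IsCholeskyFactor (R * R.transpose) R :=
  ⟨h.1, h.2, rfl⟩

theorem measurableSet_lowerTriangularPos (q : ℕ) : MeasurableSet (lowerTriangularPos q) := by
  have h : lowerTriangularPos q =
      (⋂ i, ⋂ j, ⋂ _ : i < j, {R | R i j = 0}) ∩ ⋂ i, {R | 0 < R i i} := by
    ext; simp [lowerTriangularPos]
  rw [h]
  exact (MeasurableSet.iInter fun i => MeasurableSet.iInter fun j => MeasurableSet.iInter fun _ =>
      measurableSet_eq_fun (measurable_matrix_apply i j) measurable_const).inter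
    (MeasurableSet.iInter fun i => measurableSet_lt measurable_const (measurable_matrix_apply i i))

/-- An injective measurable map between standard Borel spaces is a measurable embedding
(Lusin–Souslin), so uniqueness of the factor already yields a measurable inverse without any
explicit formula. -/
theorem measurableEmbedding_mul_transpose (q : ℕ) :
    MeasurableEmbedding fun R : lowerTriangularPos q => R.1 * R.1.transpose := by
  have := (measurableSet_lowerTriangularPos q).standardBorel
  refine Measurable.measurableEmbedding ?_ ?_
  · refine measurable_matrix_iff.2 fun i j => ?_
    simp only [Matrix.mul_apply, Matrix.transpose_apply]
    exact Finset.measurable_sum _ fun k _ =>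
      ((measurable_matrix_apply i k).comp measurable_subtype_coe).mul
        ((measurable_matrix_apply j k).comp measurable_subtype_coe)
  · intro R R' h
    exact Subtype.ext ((isCholeskyFactor_mul_transpose R.2).unique ⟨R'.2.1, R'.2.2, h⟩)

theorem range_mul_transpose (q : ℕ) :
    Set.range (fun R : lowerTriangularPos q => R.1 * R.1.transpose) =
      {A : Matrix (Fin q) (Fin q) ℝ | A.PosDef} := by
  ext A
  constructor
  · rintro ⟨R, rfl⟩
    exact (isCholeskyFactor_mul_transpose R.2).posDef
  · intro hA
    have h := choleskyFactor_spec hA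
    exact ⟨⟨_, h.lower, h.diag_pos⟩, h.eq_mul_transpose.symm⟩

theorem measurableSet_posDef (q : ℕ) :
    MeasurableSet {A : Matrix (Fin q) (Fin q) ℝ | A.PosDef} := by
  rw [← range_mul_transpose]
  exact (measurableEmbedding_mul_transpose q).measurableSet_range

/-- The factor is the inverse of the embedding R ↦ R Rᵀ, extended by zero off its range, which
matches the default value in the definition. -/
theorem measurable_choleskyFactor (q : ℕ) :
    Measurable (choleskyFactor : Matrix (Fin q) (Fin q) ℝ → _) := by
  have h := (measurableEmbedding_mul_transpose q).measurable_extend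
    measurable_subtype_coe (measurable_const (a := (0 : Matrix (Fin q) (Fin q) ℝ)))
  convert h using 1
  ext1 A
  by_cases hA : A.PosDef
  · obtain ⟨R, rfl⟩ : A ∈ Set.range (fun R : lowerTriangularPos q => R.1 * R.1.transpose) := by
      rw [range_mul_transpose]; exact hA
    rw [(measurableEmbedding_mul_transpose q).injective.extend_apply]
    exact (isCholeskyFactor_mul_transpose R.2).choleskyFactor_eq
  · rw [Function.extend_apply', choleskyFactor, dif_neg hA]
    intro hR
    exact hA ((range_mul_transpose q).le hR)

theorem logCholeskyDist_sq {q : ℕ} (S M : Matrix (Fin q) (Fin q) ℝ) :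
    logCholeskyDist S M ^ 2 =
      (∑ i, ∑ j ∈ Finset.Iio i, (choleskyFactor S i j - choleskyFactor M i j) ^ 2) +
        ∑ i, (Real.log (choleskyFactor S i i) - Real.log (choleskyFactor M i i)) ^ 2 :=
  Real.sq_sqrt (add_nonneg (Finset.sum_nonneg fun _ _ => Finset.sum_nonneg fun _ _ => sq_nonneg _)
    (Finset.sum_nonneg fun _ _ => sq_nonneg _))

/-! ### Gram-Schmidt and the Cholesky factor of a Gram matrix -/

open InnerProductSpace in
/-- The Cholesky factor of a Gram matrix, read off from the Gram-Schmidt process. -/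
noncomputable def gramCholesky {q : ℕ} {E : Type*} [NormedAddCommGroup E] [InnerProductSpace ℝ E]
    (g : Fin q → E) : Matrix (Fin q) (Fin q) ℝ :=
  fun k j => inner ℝ (gramSchmidtNormed ℝ g j) (g k)

section GramSchmidt

open InnerProductSpace

variable {q : ℕ} {E : Type*} [NormedAddCommGroup E] [InnerProductSpace ℝ E] {g : Fin q → E}

theorem gramCholesky_of_lt {k j : Fin q} (h : k < j) : gramCholesky g k j = 0 := by
  rw [gramCholesky, gramSchmidtNormed, inner_smul_left, gramSchmidt_inv_triangular ℝ g h, mul_zero]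

theorem gramCholesky_self (j : Fin q) : gramCholesky g j j = ‖gramSchmidt ℝ g j‖ := by
  rw [gramCholesky, gramSchmidtNormed, inner_smul_left, gramSchmidt_def' ℝ g j, inner_add_right,
    inner_sum, Finset.sum_eq_zero, add_zero, real_inner_self_eq_norm_sq]
  -- In the degenerate case the normalised vector is zero too, since 0⁻¹ = 0, so no independence of
  -- the family is required.
  · rcases eq_or_ne ‖gramSchmidt ℝ g j‖ 0 with h | h
    · simp [h]
    · simp; field_simp
  · intro i hi
    rw [Submodule.starProjection_singleton, inner_smul_right,
      gramSchmidt_orthogonal ℝ g (Finset.mem_Iio.1 hi).ne', mul_zero]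

/-- Each g k expands in the orthonormalised family with coefficients the k-th row of `gramCholesky
g`; the factorisation is then Parseval's identity. -/
theorem isCholeskyFactor_gram (h : ∀ i, gramSchmidt ℝ g i ≠ 0) :
    IsCholeskyFactor (fun i k => inner ℝ (g i) (g k)) (gramCholesky g) where
  lower i j hij := gramCholesky_of_lt hij
  diag_pos i := by rw [gramCholesky_self]; exact norm_pos_iff.2 (h i)
  eq_mul_transpose := by
    have hn : ∀ i, gramSchmidtNormed ℝ g i ≠ 0 := fun i =>
      smul_ne_zero (by simpa using h i) (h i)
    have ho : Orthonormal ℝ (gramSchmidtNormed ℝ g) := by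
      refine ⟨fun i => gramSchmidtNormed_unit_length' (hn i), fun i j hij => ?_⟩
      simp [gramSchmidtNormed, inner_smul_left, inner_smul_right, gramSchmidt_orthogonal ℝ g hij]
    have hs : ∀ k, ∑ j, inner ℝ (gramSchmidtNormed ℝ g j) (g k) • gramSchmidtNormed ℝ g j
        = g k := by
      intro k
      have hmem : g k ∈ Submodule.span ℝ (Set.range (gramSchmidtNormed ℝ g)) := by
        rw [span_gramSchmidtNormed_range, span_gramSchmidt]
        exact Submodule.subset_span ⟨k, rfl⟩
      obtain ⟨c, hc⟩ := (Submodule.mem_span_range_iff_exists_fun ℝ).1 hmem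
      rw [← hc]
      refine Finset.sum_congr rfl fun j _ => ?_
      rw [ho.inner_right_fintype]
    ext i k
    rw [Matrix.mul_apply]
    conv_lhs => rw [← hs k, inner_sum]
    refine Finset.sum_congr rfl fun j _ => ?_
    rw [inner_smul_right, mul_comm, real_inner_comm]
    rfl

/-- Cauchy-Schwarz against a vector of norm 1 or 0. This bound supplies the square integrability of
every entry. -/
theorem abs_gramCholesky_le (k j : Fin q) : |gramCholesky g k j| ≤ ‖g k‖ := by
  refine (abs_real_inner_le_norm _ _).trans ?_
  by_cases h : gramSchmidtNormed ℝ g j = 0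
  · simp [h]
  · simp [gramSchmidtNormed_unit_length' h]

end GramSchmidt

/-! ### Density of the standard Gaussian and polar coordinates -/

section StdGaussianDensity

open Real Module

variable (E : Type*) [NormedAddCommGroup E] [InnerProductSpace ℝ E] [FiniteDimensional ℝ E]
  [MeasurableSpace E] [BorelSpace E]

/-- Both sides are finite measures with the same characteristic function, by the Gaussian Fourier
integral with parameter b = 1/2. -/
theorem stdGaussian_eq_withDensity :
    stdGaussian E = volume.withDensity fun x : E =>
      ENNReal.ofReal (exp (-‖x‖ ^ 2 / 2) / (2 * π) ^ (finrank ℝ E / 2 : ℝ)) := by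
  have hint : Integrable fun x : E => exp (-‖x‖ ^ 2 / 2) / (2 * π) ^ (finrank ℝ E / 2 : ℝ) := by
    refine Integrable.div_const ?_ _
    have h := (GaussianFourier.integrable_cexp_neg_mul_sq_norm_add (b := 1 / 2) (by simp) 0
      (0 : E)).norm
    refine h.congr (.of_forall fun x => ?_)
    simp only [Complex.norm_exp]
    congr 1
    simp [← Complex.ofReal_pow]
    ring
  have : IsFiniteMeasure (volume.withDensity fun x : E =>
      ENNReal.ofReal (exp (-‖x‖ ^ 2 / 2) / (2 * π) ^ (finrank ℝ E / 2 : ℝ))) :=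
    isFiniteMeasure_withDensity_ofReal hint.2
  refine Measure.ext_of_charFun ?_
  ext t
  rw [charFun_stdGaussian, charFun_apply, integral_withDensity_eq_integral_toReal_smul
    (by fun_prop) (.of_forall fun _ => ENNReal.ofReal_lt_top)]
  have h := GaussianFourier.integral_cexp_neg_mul_sq_norm_add (b := 1 / 2) (by simp) Complex.I t
  have hZ : ((π : ℂ) / (1 / 2)) ^ (finrank ℝ E / 2 : ℂ) =
      (((2 * π) ^ (finrank ℝ E / 2 : ℝ) : ℝ) : ℂ) := by
    rw [Complex.ofReal_cpow (by positivity)]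
    push_cast
    congr 1
    ring
  have hZ0 : (((2 * π) ^ (finrank ℝ E / 2 : ℝ) : ℝ) : ℂ) ≠ 0 := by
    rw [Complex.ofReal_ne_zero]; positivity
  rw [hZ] at h
  calc Complex.exp (-‖t‖ ^ 2 / 2)
      = (((2 * π) ^ (finrank ℝ E / 2 : ℝ) : ℝ) : ℂ)⁻¹ *
        ∫ v : E, Complex.exp (-(1 / 2) * ‖v‖ ^ 2 + Complex.I * inner ℝ t v) := by
        rw [h, inv_mul_cancel_left₀ hZ0]
        congr 1
        rw [Complex.I_sq]
        ring
    _ = _ := by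
        rw [← integral_const_mul]
        refine integral_congr_ae (.of_forall fun v => ?_)
        simp only
        rw [ENNReal.toReal_ofReal (by positivity), Complex.real_smul, real_inner_comm,
          Complex.exp_add, mul_comm Complex.I]
        push_cast
        rw [div_eq_mul_inv, show -(1 / 2 : ℂ) * ‖v‖ ^ 2 = -‖v‖ ^ 2 / 2 by ring]
        ring

variable {E} [Nontrivial E]

theorem integrable_norm_stdGaussian_iff {f : ℝ → ℝ} :
    Integrable (fun x => f ‖x‖) (stdGaussian E) ↔
      IntegrableOn (fun y => y ^ (finrank ℝ E - 1) * (exp (-y ^ 2 / 2) * f y)) (Set.Ioi 0) := by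
  rw [stdGaussian_eq_withDensity, integrable_withDensity_iff_integrable_smul' (by fun_prop)
    (.of_forall fun _ => ENNReal.ofReal_lt_top)]
  have h : ∀ x : E, (ENNReal.ofReal (exp (-‖x‖ ^ 2 / 2) /
      (2 * π) ^ (finrank ℝ E / 2 : ℝ))).toReal • f ‖x‖ =
      ((2 * π) ^ (finrank ℝ E / 2 : ℝ))⁻¹ * (exp (-‖x‖ ^ 2 / 2) * f ‖x‖) := fun x => by
    rw [ENNReal.toReal_ofReal (by positivity), smul_eq_mul]; ring
  simp_rw [h]
  rw [integrable_const_mul_iff (isUnit_iff_ne_zero.2 (by positivity)),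
    integrable_fun_norm_addHaar volume (f := fun y => exp (-y ^ 2 / 2) * f y)]
  simp only [smul_eq_mul]

theorem integral_norm_stdGaussian (f : ℝ → ℝ) :
    ∫ x, f ‖x‖ ∂(stdGaussian E) =
      (∫ y in Set.Ioi (0 : ℝ), y ^ (finrank ℝ E - 1) * (exp (-y ^ 2 / 2) * f y)) /
        ∫ y in Set.Ioi (0 : ℝ), y ^ (finrank ℝ E - 1) * exp (-y ^ 2 / 2) := by
  obtain ⟨c, hc⟩ : ∃ c : ℝ, ∀ f : ℝ → ℝ, ∫ x, f ‖x‖ ∂(stdGaussian E) =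
      c * ∫ y in Set.Ioi (0 : ℝ), y ^ (finrank ℝ E - 1) * (exp (-y ^ 2 / 2) * f y) := by
    refine ⟨((2 * π) ^ (finrank ℝ E / 2 : ℝ))⁻¹ *
      (finrank ℝ E * (volume : Measure E).real (Metric.ball 0 1)), fun f => ?_⟩
    rw [stdGaussian_eq_withDensity, integral_withDensity_eq_integral_toReal_smul
      (by fun_prop) (.of_forall fun _ => ENNReal.ofReal_lt_top)]
    have h : ∀ x : E, (ENNReal.ofReal (exp (-‖x‖ ^ 2 / 2) /
        (2 * π) ^ (finrank ℝ E / 2 : ℝ))).toReal • f ‖x‖ =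
        ((2 * π) ^ (finrank ℝ E / 2 : ℝ))⁻¹ * (exp (-‖x‖ ^ 2 / 2) * f ‖x‖) := fun x => by
      rw [ENNReal.toReal_ofReal (by positivity), smul_eq_mul]; ring
    simp_rw [h]
    rw [integral_const_mul,
      integral_fun_norm_addHaar volume (f := fun y => exp (-y ^ 2 / 2) * f y)]
    simp only [smul_eq_mul, nsmul_eq_mul]
    ring
  -- Taking f = 1 identifies c as the inverse of the radial normalising integral, so the volume of
  -- the unit ball never has to be evaluated.
  have h1 := hc fun _ => 1
  simp only [integral_const, probReal_univ, smul_eq_mul, mul_one] at h1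
  rw [hc f, eq_div_iff (right_ne_zero_of_mul_eq_one h1.symm), mul_right_comm, ← h1, one_mul]

end StdGaussianDensity

/-! ### Gamma and its derivative under t = y² / 2 -/

section HalfSquareSubstitution

open Real Set

theorem integral_Ioi_comp_half_sq (g : ℝ → ℝ) :
    ∫ t in Ioi (0 : ℝ), g t = ∫ y in Ioi (0 : ℝ), y * g (y ^ 2 / 2) := by
  have h1 := integral_comp_rpow_Ioi (fun u => g (u / 2) / 2) (two_ne_zero (α := ℝ))
  have h2 := integral_comp_mul_left_Ioi g 0 (show (0 : ℝ) < 2⁻¹ by norm_num)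
  simp only [mul_zero, inv_inv, smul_eq_mul] at h2
  have h3 : ∫ u in Ioi (0 : ℝ), g (u / 2) / 2 = ∫ t in Ioi (0 : ℝ), g t := by
    simp_rw [div_eq_inv_mul]
    rw [integral_const_mul, h2]
    ring
  rw [← h3, ← h1]
  refine setIntegral_congr_fun measurableSet_Ioi fun y hy => ?_
  simp only [smul_eq_mul]
  rw [abs_of_pos two_pos, rpow_two, show (2 : ℝ) - 1 = 1 by norm_num, rpow_one]
  ring

theorem half_sq_rpow {y : ℝ} (hy : 0 < y) {n : ℕ} (hn : n ≠ 0) :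
    y * (y ^ 2 / 2) ^ ((n : ℝ) / 2 - 1) = 2 ^ (1 - (n : ℝ) / 2) * y ^ (n - 1) := by
  rw [div_rpow (by positivity) (by positivity), ← rpow_natCast y 2, ← rpow_mul hy.le,
    ← rpow_natCast y (n - 1), Nat.cast_sub (by omega), div_eq_mul_inv, ← rpow_neg (by positivity),
    ← mul_assoc, mul_comm _ ((2 : ℝ) ^ _), neg_sub]
  congr 1
  conv_lhs => rw [← rpow_one y, ← rpow_mul hy.le, one_mul, ← rpow_add hy]
  congr 1
  push_cast
  ring

theorem gamma_half_eq_integral {n : ℕ} (hn : n ≠ 0) :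
    Gamma ((n : ℝ) / 2) =
      2 ^ (1 - (n : ℝ) / 2) * ∫ y in Ioi (0 : ℝ), y ^ (n - 1) * exp (-y ^ 2 / 2) := by
  have hn' : (0 : ℝ) < n := by positivity
  rw [Gamma_eq_integral (by positivity), integral_Ioi_comp_half_sq, ← integral_const_mul]
  refine setIntegral_congr_fun measurableSet_Ioi fun y hy => ?_
  have := half_sq_rpow hy hn
  rw [← mul_assoc (2 ^ _), ← this, neg_div]
  ring

/-- Differentiating Euler's integral brings down log t, which is 2 log y - log 2 after the
substitution. The derivative is the complex one because `Complex.digamma` is the logarithmic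
derivative of `Complex.Gamma`. -/
theorem deriv_gamma_half_eq_integral {n : ℕ} (hn : n ≠ 0) :
    deriv Complex.Gamma (((n : ℝ) / 2 : ℝ) : ℂ) =
      ((2 ^ (1 - (n : ℝ) / 2) * ∫ y in Ioi (0 : ℝ),
        y ^ (n - 1) * (exp (-y ^ 2 / 2) * (2 * log y - log 2)) : ℝ) : ℂ) := by
  have hn' : (0 : ℝ) < n := by positivity
  have hre : 0 < (((n : ℝ) / 2 : ℝ) : ℂ).re := by rw [Complex.ofReal_re]; positivity
  have hd := Complex.hasDerivAt_GammaIntegral hre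
  have hG : Complex.Gamma =ᶠ[nhds (((n : ℝ) / 2 : ℝ) : ℂ)] Complex.GammaIntegral := by
    filter_upwards [(isOpen_Ioi.preimage Complex.continuous_re).mem_nhds hre] with z hz
    exact Complex.Gamma_eq_integral hz
  rw [hG.deriv_eq, hd.deriv]
  have h : ∫ t : ℝ in Ioi 0, (t : ℂ) ^ ((((n : ℝ) / 2 : ℝ) : ℂ) - 1) *
      (Real.log t * Real.exp (-t)) =
      ((∫ t : ℝ in Ioi 0, t ^ ((n : ℝ) / 2 - 1) * (Real.log t * Real.exp (-t)) : ℝ) : ℂ) := by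
    rw [← integral_complex_ofReal]
    refine setIntegral_congr_fun measurableSet_Ioi fun t ht => ?_
    push_cast
    rw [Complex.ofReal_cpow (le_of_lt ht)]
    push_cast
    rfl
  rw [h, integral_Ioi_comp_half_sq, ← integral_const_mul]
  congr 1
  refine setIntegral_congr_fun measurableSet_Ioi fun y hy => ?_
  have h1 := half_sq_rpow hy hn
  have h2 : log (y ^ 2 / 2) = 2 * log y - log 2 := by
    rw [log_div (pow_pos hy 2).ne' two_ne_zero, log_pow]; norm_num
  rw [← mul_assoc, ← mul_assoc, ← mul_assoc, h1, h2, neg_div]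
  ring

end HalfSquareSubstitution

/-! ### Moments of the norm of a standard Gaussian and of its logarithm -/

section NormMoments

open Real Module Set

variable (E : Type*) [NormedAddCommGroup E] [InnerProductSpace ℝ E] [FiniteDimensional ℝ E]
  [MeasurableSpace E] [BorelSpace E]

theorem memLp_norm_stdGaussian : MemLp (fun x : E => ‖x‖) 2 (stdGaussian E) :=
  IsGaussian.memLp_two_id.norm

/-- For y ≤ 1, square log z ≤ z at z = y^(-1/4), whence 16 = 4². The exponent -1/2 exceeds -1, so
the bound is integrable near 0 even in dimension one, where the radial weight is trivial. -/
theorem log_sq_le {y : ℝ} (hy : 0 < y) : log y ^ 2 ≤ y ^ (2 : ℝ) + 16 * y ^ (-(1 / 2) : ℝ) := by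
  rcases le_total 1 y with h | h
  · have h1 : log y ≤ y := (log_le_sub_one_of_pos hy).trans (by linarith)
    have h2 : 0 ≤ y ^ (-(1 / 2) : ℝ) := by positivity
    rw [rpow_two]
    nlinarith [log_nonneg h]
  · have h1 : log (y ^ (-(1 / 4) : ℝ)) ≤ y ^ (-(1 / 4) : ℝ) :=
      (log_le_sub_one_of_pos (by positivity)).trans (by linarith)
    rw [log_rpow hy] at h1
    have h2 : y ^ (-(1 / 2) : ℝ) = (y ^ (-(1 / 4) : ℝ)) ^ 2 := by
      rw [← rpow_natCast, ← rpow_mul hy.le]; norm_num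
    have h3 := log_nonpos hy.le h
    have h4 : 0 ≤ y ^ (2 : ℝ) := by positivity
    have h5 := mul_self_le_mul_self (a := -(1 / 4) * log y) (by linarith) h1
    rw [h2, sq, sq]
    linarith

variable [Nontrivial E]

theorem memLp_log_norm_stdGaussian : MemLp (fun x : E => log ‖x‖) 2 (stdGaussian E) := by
  rw [memLp_two_iff_integrable_sq (Measurable.aestronglyMeasurable (by fun_prop)),
    integrable_norm_stdGaussian_iff (f := fun y => log y ^ 2)]
  have hn : 0 < finrank ℝ E := finrank_pos
  have hi : ∀ s : ℝ, -1 < s → IntegrableOn (fun x : ℝ => x ^ s * exp (-(1 / 2) * x ^ 2)) (Ioi 0) :=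
    fun s hs => integrableOn_rpow_mul_exp_neg_mul_sq (by norm_num) hs
  have hn' : (0 : ℝ) ≤ (finrank ℝ E - 1 : ℕ) := Nat.cast_nonneg _
  refine Integrable.mono' ((hi ((finrank ℝ E - 1 : ℕ) + 2) (by linarith)).add
    ((hi ((finrank ℝ E - 1 : ℕ) + (-(1 / 2))) (by linarith)).const_mul 16))
    (Measurable.aestronglyMeasurable (by fun_prop)) ?_
  filter_upwards [ae_restrict_mem measurableSet_Ioi] with y hy
  have hy' : 0 < y := hy
  rw [norm_of_nonneg (by positivity), Pi.add_apply, rpow_add hy', rpow_add hy', rpow_natCast]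
  calc _ ≤ y ^ (finrank ℝ E - 1) *
        (exp (-y ^ 2 / 2) * (y ^ (2 : ℝ) + 16 * y ^ (-(1 / 2) : ℝ))) := by
        gcongr; exact log_sq_le hy'
    _ = _ := by
        rw [show -(1 / 2) * y ^ 2 = -y ^ 2 / 2 by ring]; ring

theorem integral_norm_stdGaussian_eq :
    ∫ x, ‖x‖ ∂(stdGaussian E) =
      √2 * (Gamma (((finrank ℝ E : ℝ) + 1) / 2) / Gamma ((finrank ℝ E : ℝ) / 2)) := by
  have hn : 0 < finrank ℝ E := finrank_pos
  have h0 := gamma_half_eq_integral hn.ne'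
  have h1 := gamma_half_eq_integral (n := finrank ℝ E + 1) (by omega)
  rw [integral_norm_stdGaussian fun y => y]
  -- The extra factor y raises the dimension by one, which turns the numerator into Gamma at (n + 1)
  -- / 2.
  have h2 : ∫ y in Ioi (0 : ℝ), y ^ (finrank ℝ E - 1) * (exp (-y ^ 2 / 2) * y) =
      ∫ y in Ioi (0 : ℝ), y ^ (finrank ℝ E + 1 - 1) * exp (-y ^ 2 / 2) := by
    congr 1 with y
    rw [Nat.add_sub_cancel]
    obtain ⟨m, hm⟩ := Nat.exists_eq_add_of_lt hn
    rw [hm]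
    simp
    ring
  push_cast at h1
  rw [h2, h0, h1, mul_div_mul_comm, ← mul_assoc, ← rpow_sub two_pos, sqrt_eq_rpow,
    ← rpow_add two_pos]
  rw [show (1 : ℝ) / 2 + (1 - ((finrank ℝ E : ℝ) + 1) / 2 - (1 - (finrank ℝ E : ℝ) / 2)) = 0
    by ring, rpow_zero, one_mul, Nat.add_sub_cancel]

theorem integral_log_norm_stdGaussian_eq :
    ∫ x, log ‖x‖ ∂(stdGaussian E) =
      1 / 2 * (Complex.digamma (((finrank ℝ E : ℝ) / 2 : ℝ) : ℂ)).re + 1 / 2 * log 2 := by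
  have hn : 0 < finrank ℝ E := finrank_pos
  have h : (Complex.digamma (((finrank ℝ E : ℝ) / 2 : ℝ) : ℂ)).re =
      ∫ x, (2 * log ‖x‖ - log 2) ∂(stdGaussian E) := by
    rw [integral_norm_stdGaussian fun y => 2 * log y - log 2, Complex.digamma_def, logDeriv_apply,
      deriv_gamma_half_eq_integral hn.ne', Complex.Gamma_ofReal, ← Complex.ofReal_div,
      Complex.ofReal_re, gamma_half_eq_integral hn.ne', mul_div_mul_left _ _ (by positivity)]
  have hi : Integrable (fun x : E => log ‖x‖) (stdGaussian E) :=
    (memLp_log_norm_stdGaussian E).integrable one_le_two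
  rw [h, integral_sub (hi.const_mul 2) (integrable_const _), integral_const_mul, integral_const,
    probReal_univ, one_smul]
  ring

end NormMoments

/-! ### Resampling one coordinate and transposing product measures -/

section PiMeasure

variable {ι κ X : Type*} [Fintype ι] [Fintype κ] [MeasurableSpace X]

/-- Replacing coordinate j by an independent copy leaves the law unchanged. With Fubini this plays
the role of conditioning on the other coordinates. -/
theorem pi_map_update {ι : Type*} [Fintype ι] [DecidableEq ι] {X : ι → Type*}
    [∀ i, MeasurableSpace (X i)] (μ : ∀ i, Measure (X i)) [∀ i, IsProbabilityMeasure (μ i)]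
    (j : ι) :
    ((Measure.pi μ).prod (μ j)).map (fun p => Function.update p.1 j p.2) = Measure.pi μ := by
  refine (Measure.pi_eq fun s hs => ?_).symm
  rw [Measure.map_apply measurable_update' (.univ_pi hs)]
  -- The overwritten coordinate of the first component is unconstrained and contributes the factor
  -- 1.
  have h : (fun p : (∀ i, X i) × X j => Function.update p.1 j p.2) ⁻¹' Set.univ.pi s =
      (Set.univ.pi (Function.update s j Set.univ)) ×ˢ s j := by
    ext ⟨g, x⟩
    simp only [Set.mem_preimage, Set.mem_univ_pi, Set.mem_prod]
    constructor
    · intro h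
      refine ⟨fun i => ?_, by simpa using h j⟩
      rcases eq_or_ne i j with rfl | hi
      · simp
      · simpa [hi] using h i
    · rintro ⟨h1, h2⟩ i
      rcases eq_or_ne i j with rfl | hi
      · simpa using h2
      · simpa [hi] using h1 i
  rw [h, Measure.prod_prod, Measure.pi_pi, ← Finset.prod_erase_mul _ _ (Finset.mem_univ j),
    ← Finset.prod_erase_mul (a := j) Finset.univ (fun i => μ i (s i)) (Finset.mem_univ j)]
  simp only [Function.update_self, measure_univ, mul_one]
  congr 1
  refine Finset.prod_congr rfl fun i hi => ?_
  rw [Function.update_of_ne (Finset.ne_of_mem_erase hi)]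

theorem pi_pi_eq_map_curry (ν : Measure X) [IsProbabilityMeasure ν] :
    (Measure.pi fun _ : ι => Measure.pi fun _ : κ => ν) =
      (Measure.pi fun _ : ι × κ => ν).map fun x i j => x (i, j) := by
  have h := Measure.infinitePi_map_curry (fun (_ : ι) (_ : κ) => ν)
  simp only [Measure.infinitePi_eq_pi] at h
  exact h.symm

theorem pi_pi_map_swap (ν : Measure X) [IsProbabilityMeasure ν] :
    (Measure.pi fun _ : ι => Measure.pi fun _ : κ => ν).map (fun x j i => x i j) =
      Measure.pi fun _ : κ => Measure.pi fun _ : ι => ν := by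
  have h : (Measure.pi fun _ : ι × κ => ν).map (fun x (p : κ × ι) => x p.swap) =
      Measure.pi fun _ : κ × ι => ν := by
    refine (Measure.pi_eq fun s hs => ?_).symm
    rw [Measure.map_apply (by fun_prop) (.univ_pi hs)]
    have : (fun (x : ι × κ → X) (p : κ × ι) => x p.swap) ⁻¹' Set.univ.pi s =
        Set.univ.pi fun p => s p.swap := by
      ext x
      simp only [Set.mem_preimage, Set.mem_univ_pi]
      exact ⟨fun h p => h p.swap, fun h p => h p.swap⟩
    rw [this, Measure.pi_pi]
    exact Fintype.prod_equiv (Equiv.prodComm ι κ) _ _ fun _ => rfl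
  rw [pi_pi_eq_map_curry, pi_pi_eq_map_curry, ← h, Measure.map_map (by fun_prop) (by fun_prop),
    Measure.map_map (by fun_prop) (by fun_prop)]
  rfl

end PiMeasure

/-! ### Gram-Schmidt vectors as orthogonal projections -/

section GramSchmidtUpdate

open InnerProductSpace Submodule Module

variable {q : ℕ} {E : Type*} [NormedAddCommGroup E] [InnerProductSpace ℝ E]

theorem gramSchmidt_congr {f g : Fin q → E} {n : Fin q} (h : ∀ i ≤ n, f i = g i) :
    gramSchmidt ℝ f n = gramSchmidt ℝ g n := by
  induction n using WellFoundedLT.induction with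
  | ind n ih =>
    rw [gramSchmidt_def, gramSchmidt_def, h n le_rfl]
    congr 1
    refine Finset.sum_congr rfl fun i hi => ?_
    have hi' := Finset.mem_Iio.1 hi
    rw [ih i hi' fun k hk => h k (hk.trans hi'.le)]

theorem finrank_span_image_Iio_le (g : Fin q → E) (j : Fin q) :
    finrank ℝ (span ℝ (g '' Set.Iio j)) ≤ j := by
  classical
  have h := finrank_span_finset_le_card (R := ℝ) ((Finset.Iio j).image g)
  rw [Finset.coe_image, Finset.coe_Iio] at h
  exact h.trans (Finset.card_image_le.trans (by simp))

theorem finrank_span_image_Iio {g : Fin q → E} (hg : ∀ i, gramSchmidt ℝ g i ≠ 0) (j : Fin q) :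
    finrank ℝ (span ℝ (g '' Set.Iio j)) = j := by
  have hli : LinearIndependent ℝ (gramSchmidt ℝ g) :=
    linearIndependent_of_ne_zero_of_inner_eq_zero hg fun _ _ => gramSchmidt_orthogonal ℝ g
  have h := finrank_span_eq_card (hli.comp ((↑) : Set.Iio j → Fin q) Subtype.coe_injective)
  rw [Set.range_comp, Subtype.range_coe] at h
  rw [← span_gramSchmidt_Iio ℝ g j, h, ← Nat.card_eq_fintype_card, Nat.card_coe_set_eq,
    Set.ncard_eq_toFinset_card', Set.toFinset_Iio, Fin.card_Iio]

variable [FiniteDimensional ℝ E]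

theorem gramSchmidt_eq_starProjection (g : Fin q → E) (j : Fin q) :
    gramSchmidt ℝ g j = (span ℝ (g '' Set.Iio j))ᗮ.starProjection (g j) := by
  symm
  refine eq_starProjection_of_mem_orthogonal ?_ ?_
  · rw [← span_gramSchmidt_Iio ℝ g j, mem_orthogonal]
    intro u hu
    induction hu using span_induction with
    | mem u hu =>
      obtain ⟨i, hi, rfl⟩ := hu
      exact gramSchmidt_orthogonal ℝ g (ne_of_lt hi)
    | zero => simp
    | add u v _ _ hu hv => rw [inner_add_left, hu, hv, add_zero]
    | smul c u _ hu => rw [inner_smul_left, hu, mul_zero]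
  · refine le_orthogonal_orthogonal _ ?_
    rw [← span_gramSchmidt_Iio ℝ g j, gramSchmidt_def, sub_sub_cancel]
    refine sum_mem fun i hi => ?_
    rw [starProjection_singleton]
    exact smul_mem _ _ (subset_span ⟨i, Finset.mem_Iio.1 hi, rfl⟩)

/-- The span of the earlier vectors does not see the update at j, so for frozen g the j-th
Gram-Schmidt vector is linear in x. -/
theorem gramSchmidt_update_eq_starProjection (g : Fin q → E) (j : Fin q) (x : E) :
    gramSchmidt ℝ (Function.update g j x) j = (span ℝ (g '' Set.Iio j))ᗮ.starProjection x := by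
  rw [gramSchmidt_eq_starProjection, Function.update_self]
  have : Function.update g j x '' Set.Iio j = g '' Set.Iio j :=
    Set.image_congr fun i hi => Function.update_of_ne (ne_of_lt hi) _ _
  rw [this]

variable [MeasurableSpace E] [BorelSpace E]

theorem measurable_gramSchmidt (j : Fin q) : Measurable fun g : Fin q → E => gramSchmidt ℝ g j := by
  induction j using WellFoundedLT.induction with
  | ind j ih =>
    simp only [gramSchmidt_def ℝ _ j, starProjection_singleton]
    refine (measurable_pi_apply j).sub (Finset.measurable_sum _ fun i hi => ?_)
    have hi' := ih i (Finset.mem_Iio.1 hi)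
    exact ((hi'.inner (measurable_pi_apply j)).div ((RCLike.continuous_ofReal.measurable.comp (hi'.norm.pow_const 2)))).smul hi'

theorem measurable_gramCholesky (k j : Fin q) :
    Measurable fun g : Fin q → E => gramCholesky g k j := by
  have h := measurable_gramSchmidt (E := E) j
  simp only [gramCholesky, gramSchmidtNormed]
  exact (h.norm.inv.smul h).inner (measurable_pi_apply k)

end GramSchmidtUpdate

/-! ### Gram-Schmidt on Gaussian vectors (Bartlett's decomposition) -/

section RandomGramSchmidt

open InnerProductSpace Submodule Module

variable {q : ℕ} {E : Type*} [NormedAddCommGroup E] [InnerProductSpace ℝ E] [FiniteDimensional ℝ E]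
  [MeasurableSpace E] [BorelSpace E]

/-- For t in K the pairing of t with x equals its pairing with the projection of x, so the
characteristic functions agree. -/
theorem stdGaussian_map_orthogonalProjection (K : Submodule ℝ E) :
    (stdGaussian E).map K.orthogonalProjectionOnto = stdGaussian K := by
  refine Measure.ext_of_charFun ?_
  ext t
  rw [charFun_stdGaussian, charFun_apply, integral_map (by fun_prop) (by fun_prop)]
  have h := charFun_stdGaussian (t : E)
  rw [charFun_apply] at h
  refine Eq.trans ?_ h
  refine integral_congr_ae (.of_forall fun x => ?_)
  simp only
  rw [inner_orthogonalProjectionOnto_eq_of_mem_right]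

theorem stdGaussian_map_norm {n : ℕ} (h : finrank ℝ E = n) :
    (stdGaussian E).map (fun x => ‖x‖) =
      (stdGaussian (EuclideanSpace ℝ (Fin n))).map fun x => ‖x‖ := by
  subst h
  rw [← stdGaussian_map (stdOrthonormalBasis ℝ E).repr, Measure.map_map (by fun_prop) (by fun_prop)]
  congr 1
  ext x
  simp

theorem ae_ne_zero_stdGaussian [Nontrivial E] : ∀ᵐ x ∂(stdGaussian E), x ≠ 0 := by
  rw [stdGaussian_eq_withDensity]
  refine (withDensity_absolutelyContinuous _ _).ae_le ?_
  exact compl_mem_ae_iff.2 (measure_singleton 0)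

variable (q E) in
/-- The law of `q` independent standard Gaussian vectors in `E`. -/
noncomputable abbrev gaussianFamily : Measure (Fin q → E) :=
  Measure.pi fun _ => stdGaussian E

theorem ae_gramSchmidt_ne_zero (hq : q ≤ finrank ℝ E) :
    ∀ᵐ g ∂(gaussianFamily q E), ∀ j, gramSchmidt ℝ g j ≠ 0 := by
  refine ae_all_iff.2 fun j => ?_
  have hm : MeasurableSet {g : Fin q → E | gramSchmidt ℝ g j ≠ 0} :=
    (measurableSet_eq_fun (measurable_gramSchmidt j) measurable_const).compl
  have hu := measurable_update' (X := fun _ : Fin q => E) (a := j)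
  rw [gaussianFamily, ← pi_map_update _ j, ae_map_iff hu.aemeasurable hm]
  refine (Measure.ae_prod_iff_ae_ae (hu hm)).2 (.of_forall fun g => ?_)
  set K := (span ℝ (g '' Set.Iio j))ᗮ with hK
  have h1 := finrank_add_finrank_orthogonal (span ℝ (g '' Set.Iio j))
  have h2 := finrank_span_image_Iio_le g j
  have h3 := j.2
  -- At most j < q ≤ dim E dimensions are spanned by the earlier vectors, so the complement is
  -- nonzero for every frozen g.
  have : Nontrivial K := nontrivial_of_finrank_pos (R := ℝ) (by rw [hK]; omega)
  have h4 := ae_ne_zero_stdGaussian (E := K)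
  rw [← stdGaussian_map_orthogonalProjection, ae_map_iff (by fun_prop)
    (p := fun x : K => x ≠ 0) (measurableSet_singleton _).compl] at h4
  filter_upwards [h4] with x hx
  rw [gramSchmidt_update_eq_starProjection, starProjection_apply]
  exact fun h => hx (Subtype.ext h)

/-- Resample the j-th vector: for almost every frozen family the earlier vectors span exactly j
dimensions (j counted from 0), so the conditional law is that of a Gaussian norm in dimension
`finrank ℝ E - j` and does not depend on the family. -/
theorem map_norm_gramSchmidt (hq : q ≤ finrank ℝ E) (j : Fin q) :
    (gaussianFamily q E).map (fun g => ‖gramSchmidt ℝ g j‖) =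
      (stdGaussian (EuclideanSpace ℝ (Fin (finrank ℝ E - j)))).map fun x => ‖x‖ := by
  have hm := (measurable_gramSchmidt (E := E) j).norm
  have hu := measurable_update' (X := fun _ : Fin q => E) (a := j)
  ext B hB
  rw [Measure.map_apply hm hB, gaussianFamily]
  conv_lhs => rw [← pi_map_update _ j]
  rw [Measure.map_apply hu (hm hB), Measure.prod_apply (hu (hm hB))]
  have h : ∀ᵐ g ∂(gaussianFamily q E),
      stdGaussian E (Prod.mk g ⁻¹' ((fun p : (Fin q → E) × E => Function.update p.1 j p.2) ⁻¹'
        ((fun g => ‖gramSchmidt ℝ g j‖) ⁻¹' B))) =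
      (stdGaussian (EuclideanSpace ℝ (Fin (finrank ℝ E - j)))).map (fun x => ‖x‖) B := by
    filter_upwards [ae_gramSchmidt_ne_zero hq] with g hg
    have h1 := finrank_add_finrank_orthogonal (span ℝ (g '' Set.Iio j))
    have h2 := finrank_span_image_Iio hg j
    rw [← stdGaussian_map_norm (E := (span ℝ (g '' Set.Iio j))ᗮ) (by omega),
      ← stdGaussian_map_orthogonalProjection, Measure.map_map (by fun_prop) (by fun_prop),
      Measure.map_apply (by fun_prop) hB]
    congr 1
    ext x
    simp only [Set.mem_preimage, gramSchmidt_update_eq_starProjection, starProjection_apply,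
      Function.comp_apply, coe_norm]
  rw [lintegral_congr_ae h, lintegral_const, measure_univ, mul_one]

/-- The j-th direction involves only vectors of index at most j < k, so after resampling the k-th
vector the entry is a fixed linear functional of a centred Gaussian. -/
theorem integral_gramCholesky_of_lt {k j : Fin q} (hkj : j < k) :
    ∫ g, gramCholesky g k j ∂(gaussianFamily q E) = 0 := by
  have hu := measurable_update' (X := fun _ : Fin q => E) (a := k)
  have hm := measurable_gramCholesky (E := E) k j
  have hn : Integrable (fun g : Fin q → E => ‖g k‖) (gaussianFamily q E) :=
    integrable_comp_eval (i := k) IsGaussian.integrable_id.norm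
  have hi : Integrable (fun g => gramCholesky g k j) (gaussianFamily q E) :=
    hn.mono' hm.aestronglyMeasurable (.of_forall fun g => abs_gramCholesky_le k j)
  have hp := pi_map_update (fun _ : Fin q => stdGaussian E) k
  rw [gaussianFamily, ← hp] at hi ⊢
  rw [integral_map hu.aemeasurable hm.aestronglyMeasurable]
  refine (integral_prod _ (hi.comp_measurable hu)).trans ?_
  refine integral_eq_zero_of_ae (.of_forall fun g => ?_)
  have h : ∀ x, gramCholesky (Function.update g k x) k j =
      innerSL ℝ (gramSchmidtNormed ℝ g j) x := fun x => by
    rw [gramCholesky, gramSchmidtNormed, gramSchmidt_congr (g := g), Function.update_self]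
    · rfl
    · exact fun i hi => Function.update_of_ne (hi.trans_lt hkj).ne _ _
  simp only [Function.comp_apply, h, integral_strongDual_stdGaussian, Pi.zero_apply]

theorem memLp_gramCholesky (k j : Fin q) :
    MemLp (fun g => gramCholesky g k j) 2 (gaussianFamily q E) := by
  have h : MemLp (fun g : Fin q → E => ‖g k‖) 2 (gaussianFamily q E) :=
    (memLp_norm_stdGaussian E).comp_measurePreserving (measurePreserving_eval _ k)
  exact h.mono (measurable_gramCholesky k j).aestronglyMeasurable
    (.of_forall fun g => by simpa using abs_gramCholesky_le k j)

theorem integral_gramCholesky_self (hq : q ≤ finrank ℝ E) (j : Fin q) :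
    ∫ g, gramCholesky g j j ∂(gaussianFamily q E) =
      √2 * (Real.Gamma (((finrank ℝ E : ℝ) - j + 1) / 2) /
        Real.Gamma (((finrank ℝ E : ℝ) - j) / 2)) := by
  have hj : (j : ℕ) < finrank ℝ E := j.2.trans_le hq
  -- Makes the Euclidean space of this dimension nontrivial, as the radial formulas require.
  have : NeZero (finrank ℝ E - j) := ⟨by omega⟩
  simp only [gramCholesky_self]
  have h := integral_map (μ := gaussianFamily q E) (f := id)
    (measurable_gramSchmidt (E := E) j).norm.aemeasurable (by fun_prop)
  simp only [id] at h
  rw [← h, map_norm_gramSchmidt hq, integral_map (by fun_prop) (by fun_prop),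
    integral_norm_stdGaussian_eq]
  simp [Nat.cast_sub hj.le]

theorem memLp_log_gramCholesky_self (hq : q ≤ finrank ℝ E) (j : Fin q) :
    MemLp (fun g => Real.log (gramCholesky g j j)) 2 (gaussianFamily q E) := by
  have hj : (j : ℕ) < finrank ℝ E := j.2.trans_le hq
  have : NeZero (finrank ℝ E - j) := ⟨by omega⟩
  simp only [gramCholesky_self]
  refine (memLp_map_measure_iff (g := Real.log) (by fun_prop)
    (measurable_gramSchmidt (E := E) j).norm.aemeasurable).1 ?_
  rw [map_norm_gramSchmidt hq, memLp_map_measure_iff (by fun_prop) (by fun_prop)]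
  exact memLp_log_norm_stdGaussian _

theorem integral_log_gramCholesky_self (hq : q ≤ finrank ℝ E) (j : Fin q) :
    ∫ g, Real.log (gramCholesky g j j) ∂(gaussianFamily q E) =
      1 / 2 * (Complex.digamma ((((finrank ℝ E : ℝ) - j) / 2 : ℝ) : ℂ)).re +
        1 / 2 * Real.log 2 := by
  have hj : (j : ℕ) < finrank ℝ E := j.2.trans_le hq
  have : NeZero (finrank ℝ E - j) := ⟨by omega⟩
  simp only [gramCholesky_self]
  have h := integral_map (μ := gaussianFamily q E) (f := Real.log)
    (measurable_gramSchmidt (E := E) j).norm.aemeasurable (by fun_prop)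
  rw [← h, map_norm_gramSchmidt hq, integral_map (by fun_prop) (by fun_prop),
    integral_log_norm_stdGaussian_eq]
  simp [Nat.cast_sub hj.le]

end RandomGramSchmidt

/-! ### Transfer to the Wishart law -/

section Wishart

open InnerProductSpace Module

variable {q d : ℕ} {C L : Matrix (Fin q) (Fin q) ℝ}

theorem multivariateGaussian_eq_map (hL : C = L * L.transpose) :
    multivariateGaussian (0 : EuclideanSpace ℝ (Fin q)) C =
      (stdGaussian (EuclideanSpace ℝ (Fin q))).map (Matrix.toEuclideanCLM (𝕜 := ℝ) L) := by
  have hC : C.PosSemidef := by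
    rw [hL, ← Matrix.conjTranspose_eq_transpose_of_trivial]
    exact Matrix.posSemidef_self_mul_conjTranspose L
  refine Measure.ext_of_charFun ?_
  ext t
  rw [charFun_multivariateGaussian hC, charFun_apply, integral_map (by fun_prop) (by fun_prop)]
  have h := charFun_stdGaussian ((Matrix.toEuclideanCLM (𝕜 := ℝ) L).adjoint t)
  rw [charFun_apply] at h
  simp only [ContinuousLinearMap.adjoint_inner_right] at h
  rw [h, inner_zero_right, Complex.ofReal_zero, zero_mul, zero_sub, ← Complex.ofReal_pow,
    ← real_inner_self_eq_norm_sq, ContinuousLinearMap.adjoint_inner_left,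
    ← ContinuousLinearMap.star_eq_adjoint, ← map_star, ← ContinuousLinearMap.comp_apply,
    ← ContinuousLinearMap.mul_def, ← map_mul,
    Matrix.star_eq_conjTranspose, Matrix.conjTranspose_eq_transpose_of_trivial, ← hL,
    Matrix.inner_toEuclideanCLM, neg_div]

theorem pi_stdGaussian_eq_map (ι κ : Type*) [Fintype ι] [Fintype κ] :
    (Measure.pi fun _ : ι => stdGaussian (EuclideanSpace ℝ κ)) =
      (Measure.pi fun _ : ι => Measure.pi fun _ : κ => gaussianReal 0 1).map
        fun x i => WithLp.toLp 2 (x i) := by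
  rw [Measure.pi_map_pi (f := fun _ : ι => WithLp.toLp (V := κ → ℝ) 2) (by fun_prop)]
  simp only [map_pi_eq_stdGaussian]

/-- The Gram matrix of a family of vectors. -/
noncomputable def gramMatrix {E : Type*} [NormedAddCommGroup E] [InnerProductSpace ℝ E]
    (g : Fin q → E) : Matrix (Fin q) (Fin q) ℝ :=
  fun i k => inner ℝ (g i) (g k)

theorem measurable_conj_gramMatrix {E : Type*} [NormedAddCommGroup E] [InnerProductSpace ℝ E]
    [FiniteDimensional ℝ E] [MeasurableSpace E] [BorelSpace E] (L : Matrix (Fin q) (Fin q) ℝ) :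
    Measurable fun g : Fin q → E => L * gramMatrix g * L.transpose := by
  refine measurable_matrix_iff.2 fun i j => ?_
  simp only [Matrix.mul_apply, gramMatrix]
  fun_prop

theorem sum_vecMulVec_mulVec (x : Fin q → Fin d → ℝ) :
    ∑ k, Matrix.vecMulVec (L.mulVec fun i => x i k) (L.mulVec fun i => x i k) =
      L * gramMatrix (fun i => WithLp.toLp 2 (x i)) * L.transpose := by
  have h : gramMatrix (fun i => WithLp.toLp 2 (x i)) =
      ∑ k, Matrix.vecMulVec (fun i => x i k) (fun i => x i k) := by
    ext i j
    rw [Matrix.sum_apply]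
    simp [gramMatrix, Matrix.vecMulVec_apply, PiLp.inner_apply, mul_comm]
  rw [h, Matrix.mul_sum, Matrix.sum_mul]
  refine Finset.sum_congr rfl fun k _ => ?_
  rw [Matrix.mul_vecMulVec, Matrix.vecMulVec_mul, Matrix.vecMul_transpose]

/-- The d vectors of ℝ^q form an array of independent scalar normals up to the linear map L;
transposing the array gives q standard Gaussian vectors in ℝ^d, and the sum of outer products
becomes their Gram matrix. -/
theorem wishartMeasure_eq_map (hL : C = L * L.transpose) :
    wishartMeasure q d C = (gaussianFamily q (EuclideanSpace ℝ (Fin d))).map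
      fun g => L * gramMatrix g * L.transpose := by
  have hF : Measurable fun X : Fin d → EuclideanSpace ℝ (Fin q) =>
      ∑ k : Fin d, Matrix.vecMulVec (X k).ofLp (X k).ofLp := by
    refine measurable_matrix_iff.2 fun i j => ?_
    simp only [Matrix.sum_apply, Matrix.vecMulVec_apply]
    fun_prop
  have hA : Measurable fun (X : Fin d → EuclideanSpace ℝ (Fin q)) k =>
      Matrix.toEuclideanCLM (𝕜 := ℝ) L (X k) :=
    measurable_pi_lambda _ fun k =>
      (Matrix.toEuclideanCLM (𝕜 := ℝ) L).measurable.comp (measurable_pi_apply k)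
  have hrows : Measurable fun (x : Fin d → Fin q → ℝ) k => WithLp.toLp 2 (x k) := by fun_prop
  have hcols : Measurable fun (x : Fin q → Fin d → ℝ) i => WithLp.toLp 2 (x i) := by fun_prop
  have hswap : Measurable fun (x : Fin q → Fin d → ℝ) k i => x i k := by fun_prop
  have h1 : (Measure.pi fun _ : Fin d =>
      multivariateGaussian (0 : EuclideanSpace ℝ (Fin q)) C) =
      (Measure.pi fun _ : Fin d => stdGaussian (EuclideanSpace ℝ (Fin q))).map
        fun X k => Matrix.toEuclideanCLM (𝕜 := ℝ) L (X k) := by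
    rw [Measure.pi_map_pi fun _ => (Matrix.toEuclideanCLM (𝕜 := ℝ) L).measurable.aemeasurable]
    simp only [multivariateGaussian_eq_map hL]
  rw [wishartMeasure, h1, gaussianFamily, pi_stdGaussian_eq_map, pi_stdGaussian_eq_map,
    ← pi_pi_map_swap (ι := Fin q), Measure.map_map hrows hswap,
    Measure.map_map hA (hrows.comp hswap), Measure.map_map hF (hA.comp (hrows.comp hswap)),
    Measure.map_map (measurable_conj_gramMatrix L) hcols]
  congr 1
  ext1 x
  exact sum_vecMulVec_mulVec x

theorem ae_isCholeskyFactor_conj_gramMatrix (hd : q ≤ d) (hL : IsCholeskyFactor C L) :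
    ∀ᵐ g ∂(gaussianFamily q (EuclideanSpace ℝ (Fin d))),
      IsCholeskyFactor (L * gramMatrix g * L.transpose) (L * gramCholesky g) := by
  filter_upwards [ae_gramSchmidt_ne_zero (q := q) (E := EuclideanSpace ℝ (Fin d))
    (by simpa using hd)] with g hg
  exact (isCholeskyFactor_gram hg).mul_left hL

theorem ae_posDef_wishartMeasure (hd : q ≤ d) (hL : IsCholeskyFactor C L) :
    ∀ᵐ S ∂(wishartMeasure q d C), S.PosDef := by
  rw [wishartMeasure_eq_map hL.eq_mul_transpose,
    ae_map_iff (measurable_conj_gramMatrix L).aemeasurable (measurableSet_posDef q)]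
  filter_upwards [ae_isCholeskyFactor_conj_gramMatrix hd hL] with g hg using hg.posDef

theorem map_choleskyFactor_wishartMeasure (hd : q ≤ d) (hL : IsCholeskyFactor C L) :
    (wishartMeasure q d C).map choleskyFactor =
      (gaussianFamily q (EuclideanSpace ℝ (Fin d))).map fun g => L * gramCholesky g := by
  rw [wishartMeasure_eq_map hL.eq_mul_transpose,
    Measure.map_map (measurable_choleskyFactor q) (measurable_conj_gramMatrix L)]
  refine Measure.map_congr ?_
  filter_upwards [ae_isCholeskyFactor_conj_gramMatrix hd hL] with g hg using hg.choleskyFactor_eq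

theorem measurable_mul_gramCholesky {E : Type*} [NormedAddCommGroup E] [InnerProductSpace ℝ E]
    [FiniteDimensional ℝ E] [MeasurableSpace E] [BorelSpace E] (L : Matrix (Fin q) (Fin q) ℝ) :
    Measurable fun g : Fin q → E => L * gramCholesky g := by
  refine measurable_matrix_iff.2 fun i j => ?_
  simp only [Matrix.mul_apply]
  exact Finset.measurable_sum _ fun k _ => (measurable_gramCholesky k j).const_mul _

theorem memLp_choleskyFactor_wishartMeasure_iff (hd : q ≤ d) (hL : IsCholeskyFactor C L)
    {f : Matrix (Fin q) (Fin q) ℝ → ℝ} (hf : Measurable f) :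
    MemLp (fun S => f (choleskyFactor S)) 2 (wishartMeasure q d C) ↔
      MemLp (fun g => f (L * gramCholesky g)) 2
        (gaussianFamily q (EuclideanSpace ℝ (Fin d))) := by
  have h1 := memLp_map_measure_iff (p := 2) (μ := wishartMeasure q d C)
    hf.aestronglyMeasurable (measurable_choleskyFactor q).aemeasurable
  rw [map_choleskyFactor_wishartMeasure hd hL, memLp_map_measure_iff hf.aestronglyMeasurable
    (measurable_mul_gramCholesky L).aemeasurable] at h1
  exact h1.symm

theorem integral_choleskyFactor_wishartMeasure (hd : q ≤ d) (hL : IsCholeskyFactor C L)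
    {f : Matrix (Fin q) (Fin q) ℝ → ℝ} (hf : Measurable f) :
    ∫ S, f (choleskyFactor S) ∂(wishartMeasure q d C) =
      ∫ g, f (L * gramCholesky g) ∂(gaussianFamily q (EuclideanSpace ℝ (Fin d))) := by
  rw [← integral_map (measurable_choleskyFactor q).aemeasurable hf.aestronglyMeasurable,
    map_choleskyFactor_wishartMeasure hd hL,
    integral_map (measurable_mul_gramCholesky L).aemeasurable hf.aestronglyMeasurable]

theorem memLp_choleskyFactor_apply (hd : q ≤ d) (hL : IsCholeskyFactor C L) (i j : Fin q) :
    MemLp (fun S => choleskyFactor S i j) 2 (wishartMeasure q d C) := by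
  rw [memLp_choleskyFactor_wishartMeasure_iff hd hL (measurable_matrix_apply i j)]
  simp only [Matrix.mul_apply]
  exact memLp_finsetSum _ fun k _ => (memLp_gramCholesky k j).const_mul _

/-- In the sum over k of L i k times the mean of G k j only k = j survives: entries above the
diagonal vanish and those below have mean zero. -/
theorem integral_choleskyFactor_apply (hd : q ≤ d) (hL : IsCholeskyFactor C L) (i j : Fin q) :
    ∫ S, choleskyFactor S i j ∂(wishartMeasure q d C) =
      L i j * (√2 * (Real.Gamma (((d : ℝ) - j + 1) / 2) / Real.Gamma (((d : ℝ) - j) / 2))) := by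
  rw [integral_choleskyFactor_wishartMeasure hd hL (measurable_matrix_apply i j)]
  simp only [Matrix.mul_apply]
  rw [integral_finsetSum _ fun k _ => ((memLp_gramCholesky k j).integrable one_le_two).const_mul _,
    Finset.sum_eq_single j]
  · rw [integral_const_mul, integral_gramCholesky_self (by simpa using hd)]
    simp
  · intro k _ hk
    rw [integral_const_mul]
    rcases lt_or_gt_of_ne hk with h | h
    · simp [gramCholesky_of_lt h]
    · rw [integral_gramCholesky_of_lt h, mul_zero]
  · simp

theorem ae_log_mul_gramCholesky_self (hd : q ≤ d) (hL : IsCholeskyFactor C L) (i : Fin q) :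
    (fun g => Real.log ((L * gramCholesky g) i i))
      =ᵐ[gaussianFamily q (EuclideanSpace ℝ (Fin d))]
      fun g => Real.log (L i i) + Real.log (gramCholesky g i i) := by
  filter_upwards [ae_gramSchmidt_ne_zero (q := q) (E := EuclideanSpace ℝ (Fin d))
    (by simpa using hd)] with g hg
  rw [← Real.log_mul (hL.diag_pos i).ne' ((isCholeskyFactor_gram hg).diag_pos i).ne',
    Matrix.mul_apply, Finset.sum_eq_single i]
  · intro k _ hk
    rcases lt_or_gt_of_ne hk with h | h
    · rw [gramCholesky_of_lt h, mul_zero]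
    · rw [hL.lower i k h, zero_mul]
  · simp

theorem memLp_log_choleskyFactor_self (hd : q ≤ d) (hL : IsCholeskyFactor C L) (i : Fin q) :
    MemLp (fun S => Real.log (choleskyFactor S i i)) 2 (wishartMeasure q d C) := by
  rw [memLp_choleskyFactor_wishartMeasure_iff hd hL (f := fun R => Real.log (R i i))
    (measurable_matrix_apply i i).log, memLp_congr_ae (ae_log_mul_gramCholesky_self hd hL i)]
  have hq : q ≤ finrank ℝ (EuclideanSpace ℝ (Fin d)) := by simpa using hd
  have h := memLp_log_gramCholesky_self hq i
  exact (memLp_const (Real.log (L i i))).add h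

theorem integral_log_choleskyFactor_self (hd : q ≤ d) (hL : IsCholeskyFactor C L) (i : Fin q) :
    ∫ S, Real.log (choleskyFactor S i i) ∂(wishartMeasure q d C) =
      Real.log (L i i * √2 *
        Real.exp (1 / 2 * (Complex.digamma ((((d : ℝ) - i) / 2 : ℝ) : ℂ)).re)) := by
  have hq : q ≤ finrank ℝ (EuclideanSpace ℝ (Fin d)) := by simpa using hd
  rw [integral_choleskyFactor_wishartMeasure hd hL (f := fun R => Real.log (R i i))
    (measurable_matrix_apply i i).log, integral_congr_ae (ae_log_mul_gramCholesky_self hd hL i),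
    integral_add (integrable_const _) ((memLp_log_gramCholesky_self hq i).integrable one_le_two),
    integral_log_gramCholesky_self hq, integral_const, probReal_univ, one_smul,
    Real.log_mul (mul_pos (hL.diag_pos i) (by positivity)).ne' (Real.exp_pos _).ne', Real.log_exp,
    Real.log_mul (hL.diag_pos i).ne' (by positivity), Real.log_sqrt zero_le_two,
    finrank_euclideanSpace_fin]
  ring

end Wishart

/-! ### Bias-variance decomposition and uniqueness of the minimiser -/

section Frechet

variable {Ω : Type*} [MeasurableSpace Ω] {P : Measure Ω}

theorem integral_sub_const_sq [IsProbabilityMeasure P] {Y : Ω → ℝ} (hY : MemLp Y 2 P) (c : ℝ) :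
    ∫ ω, (Y ω - c) ^ 2 ∂P = ∫ ω, (Y ω - ∫ ω', Y ω' ∂P) ^ 2 ∂P + (∫ ω, Y ω ∂P - c) ^ 2 := by
  have h1 : Integrable Y P := hY.integrable one_le_two
  have key : ∀ c : ℝ, ∫ ω, (Y ω - c) ^ 2 ∂P = ∫ ω, Y ω ^ 2 ∂P - 2 * c * ∫ ω, Y ω ∂P + c ^ 2 := by
    intro c
    have : ∀ ω, (Y ω - c) ^ 2 = Y ω ^ 2 - 2 * c * Y ω + c ^ 2 := fun ω => by ring
    simp only [this]
    rw [integral_add (f := fun ω => Y ω ^ 2 - 2 * c * Y ω) (hY.integrable_sq.sub (h1.const_mul _))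
        (integrable_const _), integral_sub hY.integrable_sq (h1.const_mul _), integral_const_mul, integral_const,
      probReal_univ, one_smul]
  rw [key, key]
  ring

variable {q : ℕ} {S : Ω → Matrix (Fin q) (Fin q) ℝ}

theorem integrable_logCholeskyDist_sq [IsFiniteMeasure P]
    (hR : ∀ i j, MemLp (fun ω => choleskyFactor (S ω) i j) 2 P)
    (hlog : ∀ i, MemLp (fun ω => Real.log (choleskyFactor (S ω) i i)) 2 P)
    (M : Matrix (Fin q) (Fin q) ℝ) : Integrable (fun ω => logCholeskyDist (S ω) M ^ 2) P := by
  simp only [logCholeskyDist_sq]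
  exact (integrable_finsetSum _ fun i _ => integrable_finsetSum _ fun j _ =>
    ((hR i j).sub (memLp_const _)).integrable_sq).add
    (integrable_finsetSum _ fun i _ => ((hlog i).sub (memLp_const _)).integrable_sq)

/-- Bias-variance decomposition of the expected squared log-Cholesky distance. -/
theorem integral_logCholeskyDist_sq [IsProbabilityMeasure P]
    (hR : ∀ i j, MemLp (fun ω => choleskyFactor (S ω) i j) 2 P)
    (hlog : ∀ i, MemLp (fun ω => Real.log (choleskyFactor (S ω) i i)) 2 P)
    {A : Matrix (Fin q) (Fin q) ℝ}
    (hA : ∀ i j, j < i → ∫ ω, choleskyFactor (S ω) i j ∂P = choleskyFactor A i j)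
    (hA' : ∀ i, ∫ ω, Real.log (choleskyFactor (S ω) i i) ∂P = Real.log (choleskyFactor A i i))
    (M : Matrix (Fin q) (Fin q) ℝ) :
    ∫ ω, logCholeskyDist (S ω) M ^ 2 ∂P =
      ∫ ω, logCholeskyDist (S ω) A ^ 2 ∂P + logCholeskyDist A M ^ 2 := by
  have hi : ∀ (M : Matrix (Fin q) (Fin q) ℝ) i j,
      Integrable (fun ω => (choleskyFactor (S ω) i j - choleskyFactor M i j) ^ 2) P :=
    fun M i j => ((hR i j).sub (memLp_const _)).integrable_sq
  have hi' : ∀ (M : Matrix (Fin q) (Fin q) ℝ) i, Integrable (fun ω =>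
      (Real.log (choleskyFactor (S ω) i i) - Real.log (choleskyFactor M i i)) ^ 2) P :=
    fun M i => ((hlog i).sub (memLp_const _)).integrable_sq
  have hsum : ∀ M : Matrix (Fin q) (Fin q) ℝ, ∫ ω, logCholeskyDist (S ω) M ^ 2 ∂P =
      (∑ i, ∑ j ∈ Finset.Iio i,
        ∫ ω, (choleskyFactor (S ω) i j - choleskyFactor M i j) ^ 2 ∂P) +
      ∑ i, ∫ ω, (Real.log (choleskyFactor (S ω) i i) - Real.log (choleskyFactor M i i)) ^ 2 ∂P := by
    intro M
    simp only [logCholeskyDist_sq]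
    rw [integral_add (integrable_finsetSum _ fun i _ => integrable_finsetSum _ fun j _ => hi M i j)
      (integrable_finsetSum _ fun i _ => hi' M i),
      integral_finsetSum _ fun i _ => integrable_finsetSum _ fun j _ => hi M i j,
      integral_finsetSum _ fun i _ => hi' M i]
    congr 1
    exact Finset.sum_congr rfl fun i _ => integral_finsetSum _ fun j _ => hi M i j
  rw [hsum, hsum, logCholeskyDist_sq, add_add_add_comm]
  refine congrArg₂ (· + ·) ?_ ?_
  · rw [← Finset.sum_add_distrib]
    refine Finset.sum_congr rfl fun i _ => ?_
    rw [← Finset.sum_add_distrib]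
    refine Finset.sum_congr rfl fun j hj => ?_
    rw [integral_sub_const_sq (hR i j), hA i j (Finset.mem_Iio.1 hj)]
  · rw [← Finset.sum_add_distrib]
    refine Finset.sum_congr rfl fun i _ => ?_
    rw [integral_sub_const_sq (hlog i), hA' i]

/-- A vanishing sum of squares forces all coordinates to agree; on the diagonal this uses
injectivity of log on the positive reals. -/
theorem eq_of_logCholeskyDist_sq_le_zero {A M : Matrix (Fin q) (Fin q) ℝ} (hA : A.PosDef)
    (hM : M.PosDef) (h : logCholeskyDist A M ^ 2 ≤ 0) : A = M := by
  rw [logCholeskyDist_sq] at h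
  have h1 : 0 ≤ ∑ i, ∑ j ∈ Finset.Iio i, (choleskyFactor A i j - choleskyFactor M i j) ^ 2 :=
    Finset.sum_nonneg fun _ _ => Finset.sum_nonneg fun _ _ => sq_nonneg _
  have h2 : 0 ≤ ∑ i, (Real.log (choleskyFactor A i i) - Real.log (choleskyFactor M i i)) ^ 2 :=
    Finset.sum_nonneg fun _ _ => sq_nonneg _
  have h3 := (Finset.sum_eq_zero_iff_of_nonneg fun i _ => Finset.sum_nonneg fun j _ =>
    sq_nonneg (choleskyFactor A i j - choleskyFactor M i j)).1 (le_antisymm (by linarith) h1)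
  have h4 := (Finset.sum_eq_zero_iff_of_nonneg fun _ _ => sq_nonneg _).1
    (le_antisymm (by linarith) h2)
  have hA' := choleskyFactor_spec hA
  have hM' := choleskyFactor_spec hM
  have h5 : choleskyFactor A = choleskyFactor M := by
    ext i j
    rcases lt_trichotomy i j with hij | rfl | hij
    · rw [hA'.lower i j hij, hM'.lower i j hij]
    · exact Real.log_injOn_pos (hA'.diag_pos i) (hM'.diag_pos i)
        (sub_eq_zero.1 (pow_eq_zero_iff two_ne_zero |>.1 (h4 i (Finset.mem_univ i))))
    · exact sub_eq_zero.1 (pow_eq_zero_iff two_ne_zero |>.1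
        ((Finset.sum_eq_zero_iff_of_nonneg fun _ _ => sq_nonneg _).1 (h3 i (Finset.mem_univ i)) j
          (Finset.mem_Iio.2 hij)))
  rw [hA'.eq_mul_transpose, hM'.eq_mul_transpose, h5]

end Frechet

/-! ### The Fréchet mean of the Wishart law -/

theorem proposition1 {Ω : Type*} [MeasurableSpace Ω] (P : Measure Ω) [IsProbabilityMeasure P]
    (q d : ℕ) (hd : q ≤ d)
    (C L : Matrix (Fin q) (Fin q) ℝ) (hC : C.PosDef) (hL : IsCholeskyFactor C L)
    (S : Ω → Matrix (Fin q) (Fin q) ℝ) (hS : HasLaw S (wishartMeasure q d C) P)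
    (T : Matrix (Fin q) (Fin q) ℝ)
    (hT_diag : ∀ i : Fin q, T i i = L i i * Real.sqrt 2 *
      Real.exp (1 / 2 *
        (Complex.digamma ((((d : ℝ) - (((i : ℕ) : ℝ) + 1) + 1) / 2 : ℝ) : ℂ)).re))
    (hT_lower : ∀ i j : Fin q, j < i → T i j = L i j * Real.sqrt 2 *
      (Real.Gamma (((d : ℝ) - (((j : ℕ) : ℝ) + 1) + 2) / 2) /
        Real.Gamma (((d : ℝ) - (((j : ℕ) : ℝ) + 1) + 1) / 2)))
    (hT_upper : ∀ i j : Fin q, i < j → T i j = 0) :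
    (∀ᵐ ω ∂P, (S ω).PosDef) ∧
      ∀ M : Matrix (Fin q) (Fin q) ℝ,
        IsFrechetMean {A : Matrix (Fin q) (Fin q) ℝ | A.PosDef} logCholeskyDist P S M ↔
          M = T * T.transpose := by
  have hT : IsCholeskyFactor (T * T.transpose) T := by
    refine ⟨hT_upper, fun i => ?_, rfl⟩
    rw [hT_diag]
    exact mul_pos (mul_pos (hL.diag_pos i) (by positivity)) (Real.exp_pos _)
  have hR : ∀ i j, MemLp (fun ω => choleskyFactor (S ω) i j) 2 P := fun i j => by
    have h := memLp_choleskyFactor_apply hd hL i j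
    rw [← hS.map_eq] at h
    exact h.comp_of_map hS.aemeasurable
  have hlog : ∀ i, MemLp (fun ω => Real.log (choleskyFactor (S ω) i i)) 2 P := fun i => by
    have h := memLp_log_choleskyFactor_self hd hL i
    rw [← hS.map_eq] at h
    exact h.comp_of_map hS.aemeasurable
  have hmean : ∀ i j, j < i →
      ∫ ω, choleskyFactor (S ω) i j ∂P = choleskyFactor (T * T.transpose) i j := by
    intro i j hij
    have h := integral_choleskyFactor_apply hd hL i j
    rw [← hS.integral_comp (memLp_choleskyFactor_apply hd hL i j).1] at h
    rw [hT.choleskyFactor_eq, hT_lower i j hij, mul_assoc]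
    refine h.trans ?_
    -- Indices in `Fin q` start at 0: d - (j + 1) + 2 = d - j + 1, and likewise in the denominator.
    congr 5 <;> ring
  have hmean_log : ∀ i, ∫ ω, Real.log (choleskyFactor (S ω) i i) ∂P =
      Real.log (choleskyFactor (T * T.transpose) i i) := by
    intro i
    have h := integral_log_choleskyFactor_self hd hL i
    rw [← hS.integral_comp (memLp_log_choleskyFactor_self hd hL i).1] at h
    rw [hT.choleskyFactor_eq, hT_diag i, sub_add_eq_sub_sub, sub_add_cancel]
    exact h
  have hdec := integral_logCholeskyDist_sq hR hlog hmean hmean_log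
  refine ⟨?_, fun M => ⟨fun ⟨hM, _, hmin⟩ => ?_, ?_⟩⟩
  · have h := ae_posDef_wishartMeasure hd hL
    rw [← hS.map_eq] at h
    exact ae_of_ae_map hS.aemeasurable h
  · have h := hmin _ hT.posDef
    -- Comparing M with T Tᵀ through the decomposition leaves a squared distance between them that
    -- is at most 0.
    rw [hdec M] at h
    exact (eq_of_logCholeskyDist_sq_le_zero hT.posDef hM (by linarith)).symm
  · rintro rfl
    refine ⟨hT.posDef, fun y _ => integrable_logCholeskyDist_sq hR hlog y, fun y _ => ?_⟩
    rw [hdec y]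
    exact le_add_of_nonneg_right (sq_nonneg _)
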